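/- **Setting.** Let $d\in\{2,3\}$, let $\Omega\subset\mathbb R^d$ be bounded and open with Lipschitz boundary, $\partial\Omega=\overline{\Gamma_{\rm in}}\cup\overline{\Gamma_1}\cup\overline{\Gamma_2}$ with $\Gamma_{\rm in},\Gamma_1,\Gamma_2$ disjoint, and $\Gamma=\Gamma_{\rm in}\cup\Gamma_2$. Let $z_1=1$, $z_2=-1$, $0<D_m<D_0$, $0<\epsilon_0<\epsilon_m$, $\alpha_0>0$, $p\in\{1,2,\dots\}$, and for $a\in\mathbb R$ put $$D(a)=D_m+\max\{\min\{a^p,1\},0\}(D_0-D_m),\qquad \epsilon(a)=\epsilon_m+\max\{\min\{a^p,1\},0\}(\epsilon_0-\epsilon_m).$$ Let $c_1^\infty,c_2^\infty,g\in H^1(\Omega)$ and let $H^1_{d,0}(\Omega)$ be the set of $w\in H^1(\Omega)$ with trace $0$ on $\Gamma$. *State system.* For a phase field $\phi\in H^1(\Omega)$, a solution is a triple $(c_1,c_2,\psi)\in H^1(\Omega)^3$ with $c_i-c_i^\infty,\ \psi-g\in H^1_{d,0}(\Omega)$ such that for all $s,\zeta\in H^1_{d,0}(\Omega)$ and $i=1,2$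 (the integrals being absolutely convergent) $$\int_\Omega D(\phi)(\nabla c_i+z_ic_i\nabla\psi-\alpha_0c_i\nabla\phi)\cdot\nabla s\,dx=0,\qquad \int_\Omega \epsilon(\phi)\nabla\psi\cdot\nabla\zeta-\Big(\sum_{i=1}^2z_ic_i\Big)\zeta\,dx=0 .$$ *Adjoint system.* Given $\phi$ and $(c_1,c_2,\psi)$, a solution is a triple $(s_1,s_2,\zeta)\in H^1_{d,0}(\Omega)^3$ such that for all $q,\eta\in H^1_{d,0}(\Omega)$ and $i=1,2$ (the integrals being absolutely convergent) $$\int_\Omega D(\phi)\nabla s_i\cdot(\nabla q+z_iq\nabla\psi-\alpha_0q\nabla\phi)+z_iq-z_i\zeta q\,dx=0,$$ $$\int_\Omega\epsilon(\phi)\nabla\zeta\cdot\nabla\eta\,dx+\sum_{i=1}^2\int_\Omega D(\phi)z_ic_i\nabla s_i\cdot\nabla\eta\,dx=0 .$$ **Assumptions.** Let $\phi\in W^{1,\infty}(\Omega)$ and $\theta\in H^1(\Omega)$. For small $t$ let $(\boldsymbol c(\phi+t\theta),\psi(\phi+t\theta))$ be a solution of the state system for the phase field $\phi+t\theta$ such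 that, as $t\to0$, the concentrations $c_i(\phi+t\theta)$ are bounded in $L^\infty(\Omega)$ uniformly in $t$, and $$\|c_i(\phi+t\theta)-c_i(\phi)\|_{H^1(\Omega)}+\|\psi(\phi+t\theta)-\psi(\phi)\|_{H^1(\Omega)}=O(t)$$ (as is the case if the state is Gâteaux differentiable at $\phi$ in the direction $\theta$ as an $H^1(\Omega)$-valued map). Write $c_i=c_i(\phi)$, $\psi=\psi(\phi)$, and let $(s_1,s_2,\zeta)$ solve the adjoint system at $\phi$ and $(c_1,c_2,\psi)$. Assume that $\theta\nabla c_i\cdot\nabla s_i$, $\theta\nabla\psi\cdot\nabla s_i$ and $\theta\nabla\psi\cdot\nabla\zeta$ are integrable over $\Omega$ (for every $\theta\in H^1(\Omega)$ this is automatic if $\nabla c_i,\nabla\psi\in L^4(\Omega)$). **Theorem.** Let $\mathcal J(\boldsymbol c)=-\int_\Omega\sum_{i=1}^2z_ic_i\,dx$. (a) If the assumptions hold for $t\to0^+$, then the function $t\mapsto\mathcal J(\boldsymbol c(\phi+t\theta))$ has a right derivative at $t=0$, equal to $$\begin{aligned}\langle\mathcal J'(\boldsymbol c(\phi)),\theta\rangle=&-\sum_{i=1}^2\int_\Omega\langle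 D'(\phi),\theta\rangle(\nabla c_i+z_ic_i\nabla\psi-\alpha_0c_i\nabla\phi)\cdot\nabla s_i\,dx-\int_\Omega\langle\epsilon'(\phi),\theta\rangle\nabla\psi\cdot\nabla\zeta\,dx\\&+\sum_{i=1}^2\int_\Omega D(\phi)\alpha_0c_i\nabla\theta\cdot\nabla s_i\,dx,\end{aligned}$$ where all the integrals converge absolutely and $\langle D'(\phi),\theta\rangle(x)=\lim_{t\to0^+}\frac{D(\phi(x)+t\theta(x))-D(\phi(x))}{t}$, and likewise for $\epsilon$. (b) If the assumptions hold for $t\to0$ (both signs), and if for almost every $x\in\Omega$ either $\theta(x)=0$ or $D$ and $\epsilon$ are differentiable at $\phi(x)$, then $t\mapsto\mathcal J(\boldsymbol c(\phi+t\theta))$ is differentiable at $t=0$, and its derivative is given by the same formula with $\langle D'(\phi),\theta\rangle=D'(\phi)\theta$ and $\langle\epsilon'(\phi),\theta\rangle=\epsilon'(\phi)\theta$ (both read as $0$ where $\theta=0$). -/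

import Mathlib

open MeasureTheory Filter Topology Set
open scoped ContDiff

noncomputable section

namespace PNP

/-- The ambient space `ℝᵈ` with its Euclidean norm. -/
abbrev E (d : ℕ) := EuclideanSpace ℝ (Fin d)

/-- `Ω` lies locally on one side of the graph of a Lipschitz function: near each boundary point,
in the direction of a unit vector `e`, it is the strict epigraph of a Lipschitz function of the
coordinates orthogonal to `e`. -/
def HasLipschitzBoundary {d : ℕ} (Ω : Set (E d)) : Prop :=
  ∀ x ∈ frontier Ω, ∃ e : E d, ‖e‖ = 1 ∧ ∃ f : E d → ℝ, (∃ K, LipschitzWith K f) ∧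
    (∀ (y : E d) (t : ℝ), f (y + t • e) = f y) ∧
    ∃ r > 0, ∀ y ∈ Metric.ball x r, (y ∈ Ω ↔ f y < inner ℝ e y)

/-- `G` is the weak gradient of `u` on `Ω`. -/
def HasWeakGradient {d : ℕ} (Ω : Set (E d)) (u : E d → ℝ) (G : E d → E d) : Prop :=
  ∀ η : E d → ℝ, ContDiff ℝ ∞ η → HasCompactSupport η → tsupport η ⊆ Ω →
    ∫ x in Ω, u x • gradient η x = -∫ x in Ω, η x • G x

theorem memLp_test {d : ℕ} (Ω : Set (E d)) {η : E d → ℝ} (h : ContDiff ℝ ∞ η)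
    (hc : HasCompactSupport η) : MemLp η 2 (volume.restrict Ω) :=
  (h.continuous.memLp_of_hasCompactSupport hc).restrict Ω

theorem memLp_gradient_test {d : ℕ} (Ω : Set (E d)) {η : E d → ℝ} (h : ContDiff ℝ ∞ η)
    (hc : HasCompactSupport η) : MemLp (gradient η) 2 (volume.restrict Ω) := by
  have h1 : Continuous (fderiv ℝ η) := h.continuous_fderiv (by simp)
  have h2 : Continuous (gradient η) :=
    (InnerProductSpace.toDual ℝ (E d)).symm.continuous.comp h1
  have h3 : HasCompactSupport (gradient η) :=
    (hc.fderiv (𝕜 := ℝ)).comp_left (g := (InnerProductSpace.toDual ℝ (E d)).symm) (map_zero _)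
  exact (h2.memLp_of_hasCompactSupport h3).restrict Ω

/-- The Sobolev space `H¹(Ω)`: pairs of a function in `L²(Ω)` and its weak gradient in `L²(Ω)`
(representatives, not classes). -/
def H1Submodule {d : ℕ} (Ω : Set (E d)) : Submodule ℝ ((E d → ℝ) × (E d → E d)) where
  carrier := {w | MemLp w.1 2 (volume.restrict Ω) ∧ MemLp w.2 2 (volume.restrict Ω) ∧
    HasWeakGradient Ω w.1 w.2}
  zero_mem' := by
    refine ⟨MemLp.zero, MemLp.zero, ?_⟩
    intro η _ _ _
    simp
  add_mem' := by
    rintro u w ⟨hu, hu', hu''⟩ ⟨hw, hw', hw''⟩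
    refine ⟨hu.add hw, hu'.add hw', ?_⟩
    intro η h hc hs
    have a := hu'' η h hc hs
    have b := hw'' η h hc hs
    have i1 : Integrable (fun x => u.1 x • gradient η x) (volume.restrict Ω) :=
      memLp_one_iff_integrable.1 ((memLp_gradient_test Ω h hc).smul hu)
    have i2 : Integrable (fun x => w.1 x • gradient η x) (volume.restrict Ω) :=
      memLp_one_iff_integrable.1 ((memLp_gradient_test Ω h hc).smul hw)
    have i3 : Integrable (fun x => η x • u.2 x) (volume.restrict Ω) :=
      memLp_one_iff_integrable.1 (hu'.smul (memLp_test Ω h hc))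
    have i4 : Integrable (fun x => η x • w.2 x) (volume.restrict Ω) :=
      memLp_one_iff_integrable.1 (hw'.smul (memLp_test Ω h hc))
    simp only [Prod.fst_add, Prod.snd_add, Pi.add_apply, add_smul, smul_add]
    rw [integral_add i1 i2, integral_add i3 i4, a, b, neg_add]
  smul_mem' := by
    rintro t u ⟨hu, hu', hu''⟩
    refine ⟨hu.const_smul t, hu'.const_smul t, ?_⟩
    intro η h hc hs
    have a := hu'' η h hc hs
    simp only [Prod.smul_fst, Prod.smul_snd, Pi.smul_apply, smul_eq_mul, mul_smul]
    simp only [smul_comm _ t, integral_smul]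
    rw [a, smul_neg]

/-- The type of elements of the Sobolev space `H¹(Ω)`. -/
abbrev H1 {d : ℕ} (Ω : Set (E d)) : Type := H1Submodule Ω

/-- The function underlying an element of `H¹(Ω)`. -/
def H1.fn {d : ℕ} {Ω : Set (E d)} (u : H1 Ω) : E d → ℝ := u.1.1

/-- The weak gradient of an element of `H¹(Ω)`. -/
def H1.grad {d : ℕ} {Ω : Set (E d)} (u : H1 Ω) : E d → E d := u.1.2

/-- The norm of `H¹(Ω)`. -/
def H1.norm {d : ℕ} {Ω : Set (E d)} (u : H1 Ω) : ℝ :=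
  Real.sqrt ((∫ x in Ω, u.fn x ^ 2) + ∫ x in Ω, ‖u.grad x‖ ^ 2)

/-- `u` belongs to `W^{1,∞}(Ω)`. -/
def H1.MemW1Inf {d : ℕ} {Ω : Set (E d)} (u : H1 Ω) : Prop :=
  MemLp u.fn ⊤ (volume.restrict Ω) ∧ MemLp u.grad ⊤ (volume.restrict Ω)

/-- The surface measure of `∂Ω`, that is, the `(d-1)`-dimensional Hausdorff measure on `∂Ω`. -/
def surfaceMeasure {d : ℕ} (Ω : Set (E d)) : Measure (E d) :=
  (Measure.hausdorffMeasure ((d : ℝ) - 1)).restrict (frontier Ω)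

/-- `h ∈ L²(∂Ω)` is the trace of `u ∈ H¹(Ω)`: smooth functions on `ℝᵈ` converge to `u` in `H¹(Ω)`
while their restrictions to `∂Ω` converge to `h` in `L²(∂Ω)`. -/
def HasTrace {d : ℕ} {Ω : Set (E d)} (u : H1 Ω) (h : E d → ℝ) : Prop :=
  MemLp h 2 (surfaceMeasure Ω) ∧ ∃ v : ℕ → E d → ℝ, (∀ n, ContDiff ℝ ∞ (v n)) ∧
    Tendsto (fun n => eLpNorm (fun x => v n x - u.fn x) 2 (volume.restrict Ω)) atTop (𝓝 0) ∧
    Tendsto (fun n => eLpNorm (fun x => gradient (v n) x - u.grad x) 2 (volume.restrict Ω))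
      atTop (𝓝 0) ∧
    Tendsto (fun n => eLpNorm (fun x => v n x - h x) 2 (surfaceMeasure Ω)) atTop (𝓝 0)

/-- `u = 0` on `Γ ⊆ ∂Ω` in the sense of traces. -/
def ZeroOn {d : ℕ} {Ω : Set (E d)} (Γ : Set (E d)) (u : H1 Ω) : Prop :=
  ∃ h, HasTrace u h ∧ ∀ᵐ x ∂(surfaceMeasure Ω), x ∈ Γ → h x = 0

/-- The valences `z₁ = 1`, `z₂ = -1`. -/
def z : Fin 2 → ℝ := ![1, -1]

/-- Material parameters: diffusion and dielectric coefficients in the electrolyte (`D₀`, `ε₀`) and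
in the electrode (`Dₘ`, `εₘ`), the repulsion strength `α₀` and the interpolation exponent `p`. -/
structure Params where
  D₀ : ℝ
  Dₘ : ℝ
  ε₀ : ℝ
  εₘ : ℝ
  α₀ : ℝ
  p : ℕ
  Dₘ_pos : 0 < Dₘ
  Dₘ_lt : Dₘ < D₀
  ε₀_pos : 0 < ε₀
  ε₀_lt : ε₀ < εₘ
  α₀_pos : 0 < α₀
  p_pos : 0 < p

/-- The diffusion function `D`. -/
def Params.D (P : Params) (a : ℝ) : ℝ := P.Dₘ + max (min (a ^ P.p) 1) 0 * (P.D₀ - P.Dₘ)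

/-- The dielectric function `ε`. -/
def Params.ε (P : Params) (a : ℝ) : ℝ := P.εₘ + max (min (a ^ P.p) 1) 0 * (P.ε₀ - P.εₘ)

/-- `∇c + z c ∇ψ - α₀ c ∇φ` for a species of valence `zi`. -/
def flux {d : ℕ} {Ω : Set (E d)} (P : Params) (zi : ℝ) (φ c ψ : H1 Ω) (x : E d) : E d :=
  c.grad x + (zi * c.fn x) • ψ.grad x - (P.α₀ * c.fn x) • φ.grad x

/-- `(c, ψ)` is a weak solution of the steady-state Poisson–Nernst–Planck system for the phase
field `φ`, with Dirichlet data `cinf`, `g` on `Γ`; all the integrals are required to exist. -/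
def IsPNPSolution {d : ℕ} {Ω : Set (E d)} (P : Params) (Γ : Set (E d)) (cinf : Fin 2 → H1 Ω)
    (g φ : H1 Ω) (c : Fin 2 → H1 Ω) (ψ : H1 Ω) : Prop :=
  (∀ i, ZeroOn Γ (c i - cinf i)) ∧ ZeroOn Γ (ψ - g) ∧
  (∀ i, ∀ s : H1 Ω, ZeroOn Γ s →
    IntegrableOn (fun x => P.D (φ.fn x) * inner ℝ (flux P (z i) φ (c i) ψ x) (s.grad x)) Ω ∧
    ∫ x in Ω, P.D (φ.fn x) * inner ℝ (flux P (z i) φ (c i) ψ x) (s.grad x) = 0) ∧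
  (∀ ζ : H1 Ω, ZeroOn Γ ζ →
    IntegrableOn (fun x => P.ε (φ.fn x) * inner ℝ (ψ.grad x) (ζ.grad x)
      - (∑ i, z i * (c i).fn x) * ζ.fn x) Ω ∧
    ∫ x in Ω, (P.ε (φ.fn x) * inner ℝ (ψ.grad x) (ζ.grad x)
      - (∑ i, z i * (c i).fn x) * ζ.fn x) = 0)

/-- `(s, ζ)` is a weak solution of the adjoint system at the phase field `φ` and the state
`(c, ψ)`; all the integrals are required to exist. -/
def IsAdjointSolution {d : ℕ} {Ω : Set (E d)} (P : Params) (Γ : Set (E d)) (φ : H1 Ω)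
    (c : Fin 2 → H1 Ω) (ψ : H1 Ω) (s : Fin 2 → H1 Ω) (ζ : H1 Ω) : Prop :=
  (∀ i, ZeroOn Γ (s i)) ∧ ZeroOn Γ ζ ∧
  (∀ i, ∀ q : H1 Ω, ZeroOn Γ q →
    IntegrableOn (fun x => P.D (φ.fn x) * inner ℝ ((s i).grad x) (flux P (z i) φ q ψ x)
      + z i * q.fn x - z i * ζ.fn x * q.fn x) Ω ∧
    ∫ x in Ω, (P.D (φ.fn x) * inner ℝ ((s i).grad x) (flux P (z i) φ q ψ x)
      + z i * q.fn x - z i * ζ.fn x * q.fn x) = 0) ∧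
  (∀ η : H1 Ω, ZeroOn Γ η →
    IntegrableOn (fun x => P.ε (φ.fn x) * inner ℝ (ζ.grad x) (η.grad x)) Ω ∧
    (∀ i, IntegrableOn (fun x => P.D (φ.fn x) * z i * (c i).fn x *
      inner ℝ ((s i).grad x) (η.grad x)) Ω) ∧
    (∫ x in Ω, P.ε (φ.fn x) * inner ℝ (ζ.grad x) (η.grad x))
      + ∑ i, ∫ x in Ω, P.D (φ.fn x) * z i * (c i).fn x *
          inner ℝ ((s i).grad x) (η.grad x) = 0)

/-- The net-charge objective `𝒥`. -/
def J {d : ℕ} {Ω : Set (E d)} (c : Fin 2 → H1 Ω) : ℝ :=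
  ∫ x in Ω, -∑ i, z i * (c i).fn x

/-- Along the phase fields `φ + tθ` (`t` close to `0` in the sense of the filter `l`),
`(c, ψ)` selects solutions of the state system, with concentrations uniformly bounded in `L^∞(Ω)`
and `‖c(φ + tθ) - c(φ)‖ + ‖ψ(φ + tθ) - ψ(φ)‖ = O(t)` in `H¹(Ω)`. -/
def RegularStateAlong {d : ℕ} {Ω : Set (E d)} (P : Params) (Γ : Set (E d))
    (cinf : Fin 2 → H1 Ω) (g : H1 Ω) (c : H1 Ω → Fin 2 → H1 Ω) (ψ : H1 Ω → H1 Ω)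
    (φ θ : H1 Ω) (l : Filter ℝ) : Prop :=
  (∀ᶠ t in l, IsPNPSolution P Γ cinf g (φ + t • θ) (c (φ + t • θ)) (ψ (φ + t • θ))) ∧
  (∃ M : ℝ, ∀ᶠ t in l, ∀ i, ∀ᵐ x ∂(volume.restrict Ω), |(c (φ + t • θ) i).fn x| ≤ M) ∧
  (∀ i, (fun t => (c (φ + t • θ) i - c φ i).norm) =O[l] fun t => t) ∧
  ((fun t => (ψ (φ + t • θ) - ψ φ).norm) =O[l] fun t => t)

/-- The one-sided directional derivative `lim_{t → 0⁺} (f (a + t b) - f a) / t`. -/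
def dirDeriv (f : ℝ → ℝ) (a b : ℝ) : ℝ := derivWithin (fun t => f (a + t * b)) (Ici 0) 0

/-- `-∑ᵢ ∫ dD (∇cᵢ + zᵢcᵢ∇ψ - α₀cᵢ∇φ)·∇sᵢ - ∫ dε ∇ψ·∇ζ + ∑ᵢ ∫ D(φ) α₀ cᵢ ∇θ·∇sᵢ`,
where `dD`, `dε` stand for `⟨D'(φ), θ⟩` and `⟨ε'(φ), θ⟩`. -/
def sensitivity {d : ℕ} {Ω : Set (E d)} (P : Params) (φ θ : H1 Ω) (dD dε : E d → ℝ)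
    (c : Fin 2 → H1 Ω) (ψ : H1 Ω) (s : Fin 2 → H1 Ω) (ζ : H1 Ω) : ℝ :=
  -(∑ i, ∫ x in Ω, dD x * inner ℝ (flux P (z i) φ (c i) ψ x) ((s i).grad x))
    - (∫ x in Ω, dε x * inner ℝ (ψ.grad x) (ζ.grad x))
    + ∑ i, ∫ x in Ω, P.D (φ.fn x) * P.α₀ * (c i).fn x * inner ℝ (θ.grad x) ((s i).grad x)

/-- All the integrals in `sensitivity` exist. -/
def SensitivityIntegrable {d : ℕ} {Ω : Set (E d)} (P : Params) (φ θ : H1 Ω) (dD dε : E d → ℝ)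
    (c : Fin 2 → H1 Ω) (ψ : H1 Ω) (s : Fin 2 → H1 Ω) (ζ : H1 Ω) : Prop :=
  (∀ i, IntegrableOn (fun x => dD x * inner ℝ (flux P (z i) φ (c i) ψ x) ((s i).grad x)) Ω) ∧
  IntegrableOn (fun x => dε x * inner ℝ (ψ.grad x) (ζ.grad x)) Ω ∧
  ∀ i, IntegrableOn (fun x => P.D (φ.fn x) * P.α₀ * (c i).fn x *
    inner ℝ (θ.grad x) ((s i).grad x)) Ω

end PNP

end

/-! The proof is an adjoint computation with no differentiation of the state. Write (c, ψ) for the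
state at φ and (C, Ψ) for the state at φ + tθ. Test both state systems with the adjoint state and
subtract, test the adjoint system with the increments C - c and Ψ - ψ, and add everything to J(C) -
J(c). All terms linear in the state increment cancel, which leaves an exact identity
(`hasIntegralEq_increment`): J(C) - J(c) is the integral of terms carrying the increment of D(φ) or
ε(φ), a term with t∇θ, and a quadratic remainder D(φ) zᵢ (Cᵢ - cᵢ) ∇(Ψ - ψ)·∇sᵢ.

After division by t, two limit theorems suffice. Terms in which a difference quotient of D or ε
multiplies a fixed gradient product converge by domination (`integralsTendsto_weight`): D and ε are
globally Lipschitz, so the quotient is at most L|θ|, and |Cᵢ| ≤ M. The same theorem handles the ∇θ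
term. The other terms pair a bounded factor tending to 0 a.e. with the gradient of (C - c)/t or (Ψ -
ψ)/t, which the O(t) hypothesis only bounds in L²; they vanish by Cauchy–Schwarz
(`integralsTendsto_zero`). The quadratic remainder is of this kind because Cᵢ - cᵢ is bounded and
tends to 0 a.e.

Almost everywhere convergence of C is available only along subsequences, so the limit is proved for
sequences of step sizes and recovered from the subsequence principle (`sensitivity_of_filter`). The
pointwise input is that truncated powers have one-sided directional derivatives everywhere. -/

noncomputable section

namespace PNP

/-! ### The truncated power -/

/-- The power `a ^ p` truncated to `[0, 1]`. -/
def truncPow (p : ℕ) (a : ℝ) : ℝ := max (min (a ^ p) 1) 0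

theorem truncPow_nonneg (p : ℕ) (a : ℝ) : 0 ≤ truncPow p a := le_max_right _ _

theorem truncPow_le_one (p : ℕ) (a : ℝ) : truncPow p a ≤ 1 :=
  max_le (min_le_right _ _) zero_le_one

theorem continuous_truncPow (p : ℕ) : Continuous (truncPow p) := by
  unfold truncPow
  fun_prop

/-- Truncating the argument to `[-1, 1]` does not change the truncated power. -/
theorem truncPow_clamp (p : ℕ) (a : ℝ) : truncPow p (max (min a 1) (-1)) = truncPow p a := by
  rcases le_total a 1 with h1 | h1
  · rcases le_total (-1) a with h2 | h2
    · rw [min_eq_left h1, max_eq_left h2]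
    · rw [min_eq_left h1, max_eq_right h2]
      -- Below -1 the parity of p decides: an even power truncates to 1 and an odd one to 0, with
      -- the same value at -1.
      have h3 : 1 ≤ (-a) ^ p := one_le_pow₀ (by linarith)
      unfold truncPow
      rcases Nat.even_or_odd p with hp | hp
      · rw [hp.neg_pow] at h3
        rw [hp.neg_pow, one_pow, min_eq_right h3, min_self]
      · rw [hp.neg_pow] at h3
        rw [hp.neg_pow, one_pow, max_eq_right ((min_le_left _ _).trans (by norm_num)),
          max_eq_right ((min_le_left _ _).trans (by linarith))]
  · rw [min_eq_right h1, max_eq_left (by norm_num)]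
    unfold truncPow
    rw [one_pow, min_self, min_eq_right (one_le_pow₀ h1)]

/-- A power is only locally Lipschitz, but both arguments can first be clamped to [-1, 1], where its
Lipschitz constant is p; clamping and truncating are 1-Lipschitz. -/
theorem abs_truncPow_sub_le (p : ℕ) (a b : ℝ) :
    |truncPow p a - truncPow p b| ≤ p * |a - b| := by
  have abs_clamp : ∀ x : ℝ, |max (min x 1) (-1)| ≤ 1 := fun x =>
    abs_le.2 ⟨le_max_right _ _, max_le (min_le_right _ _) (by norm_num)⟩
  have min_sub : ∀ x y : ℝ, |min x 1 - min y 1| ≤ |x - y| := fun x y => by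
    simpa using abs_min_sub_min_le_max x 1 y 1
  rw [← truncPow_clamp p a, ← truncPow_clamp p b]
  have hle : |max (min a 1) (-1) - max (min b 1) (-1)| ≤ |a - b| :=
    (abs_max_sub_max_le_abs _ _ _).trans (min_sub _ _)
  generalize hx : max (min a 1) (-1) = x at *
  generalize hy : max (min b 1) (-1) = y at *
  have hmax : max |x| |y| ≤ 1 := max_le (hx ▸ abs_clamp a) (hy ▸ abs_clamp b)
  calc |truncPow p x - truncPow p y| ≤ |x ^ p - y ^ p| :=
        (abs_max_sub_max_le_abs _ _ _).trans (min_sub _ _)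
    _ ≤ |x - y| * p * max |x| |y| ^ (p - 1) := abs_pow_sub_pow_le x y p
    _ ≤ |x - y| * p * 1 := by
        gcongr
        exact pow_le_one₀ ((abs_nonneg x).trans (le_max_left _ _)) hmax
    _ ≤ p * |a - b| := by
        rw [mul_one, mul_comm]
        gcongr

/-- If the values at a differ, the maximum locally coincides with one of the functions. If they
agree, division by t - a > 0 commutes with the maximum, so the slope of the maximum is the maximum
of the slopes; this is where one-sidedness is needed. -/
theorem differentiableWithinAt_max {f g : ℝ → ℝ} {a : ℝ}
    (hf : DifferentiableWithinAt ℝ f (Ici a) a) (hg : DifferentiableWithinAt ℝ g (Ici a) a) :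
    DifferentiableWithinAt ℝ (fun t => max (f t) (g t)) (Ici a) a := by
  rcases lt_trichotomy (f a) (g a) with h | h | h
  · refine hg.congr_of_eventuallyEq ?_ (max_eq_right h.le)
    filter_upwards [hf.continuousWithinAt.eventually_lt hg.continuousWithinAt h] with t ht
      using max_eq_right ht.le
  · have hf' := hf.hasDerivWithinAt.Ioi_of_Ici
    have hg' := hg.hasDerivWithinAt.Ioi_of_Ici
    rw [hasDerivWithinAt_iff_tendsto_slope' self_notMem_Ioi] at hf' hg'
    refine HasDerivWithinAt.differentiableWithinAt
      (f' := max (derivWithin f (Ici a) a) (derivWithin g (Ici a) a))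
      (HasDerivWithinAt.Ici_of_Ioi ?_)
    rw [hasDerivWithinAt_iff_tendsto_slope' self_notMem_Ioi]
    refine (hf'.max hg').congr' ?_
    filter_upwards [self_mem_nhdsWithin] with t ht
    have ht' : 0 ≤ t - a := sub_nonneg.2 (le_of_lt ht)
    rw [slope_def_field, slope_def_field, slope_def_field, max_div_div_right ht', h, max_self,
      max_sub_sub_right]
  · refine hf.congr_of_eventuallyEq ?_ (max_eq_left h.le)
    filter_upwards [hg.continuousWithinAt.eventually_lt hf.continuousWithinAt h] with t ht
      using max_eq_left ht.le

theorem differentiableWithinAt_truncPow (p : ℕ) (a b : ℝ) :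
    DifferentiableWithinAt ℝ (fun t : ℝ => truncPow p (a + t * b)) (Ici 0) 0 := by
  have h : DifferentiableWithinAt ℝ (fun t : ℝ => (a + t * b) ^ p) (Ici 0) 0 := by fun_prop
  have h' : DifferentiableWithinAt ℝ (fun t : ℝ => min ((a + t * b) ^ p) 1) (Ici 0) 0 := by
    -- The minimum is reduced to the maximum by changing signs.
    have h'' : DifferentiableWithinAt ℝ (fun t : ℝ => -max (-(a + t * b) ^ p) (-1)) (Ici 0) 0 :=
      (differentiableWithinAt_max h.fun_neg (differentiableWithinAt_const (c := (-1 : ℝ)))).fun_neg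
    simpa only [max_neg_neg, neg_neg] using h''
  exact differentiableWithinAt_max h' (differentiableWithinAt_const (c := (0 : ℝ)))

/-- The properties of the material laws used below: continuity, boundedness, Lipschitz continuity,
and one-sided directional differentiability. -/
structure MaterialLaw (f : ℝ → ℝ) (M L : ℝ) : Prop where
  continuous : Continuous f
  abs_le : ∀ a, |f a| ≤ M
  abs_sub_le : ∀ a b, |f a - f b| ≤ L * |a - b|
  diff : ∀ a b, DifferentiableWithinAt ℝ (fun t : ℝ => f (a + t * b)) (Ici 0) 0

theorem materialLaw_truncPow (p : ℕ) (A B : ℝ) :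
    MaterialLaw (fun a => A + truncPow p a * B) (|A| + |B|) (p * |B|) where
  continuous := continuous_const.add ((continuous_truncPow p).mul continuous_const)
  abs_le a := by
    refine (abs_add_le _ _).trans ?_
    rw [abs_mul, abs_of_nonneg (truncPow_nonneg p a)]
    have := mul_le_mul_of_nonneg_right (truncPow_le_one p a) (abs_nonneg B)
    linarith
  abs_sub_le a b := by
    have h := mul_le_mul_of_nonneg_right (abs_truncPow_sub_le p a b) (abs_nonneg B)
    rw [← abs_mul] at h
    calc _ = |(truncPow p a - truncPow p b) * B| := by congr 1; ring
      _ ≤ _ := h.trans (le_of_eq (by ring))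
  diff a b := (differentiableWithinAt_const A).add
    ((differentiableWithinAt_truncPow p a b).mul (differentiableWithinAt_const B))

theorem Params.exists_materialLaw_D (P : Params) : ∃ M L, MaterialLaw P.D M L :=
  ⟨_, _, materialLaw_truncPow P.p P.Dₘ (P.D₀ - P.Dₘ)⟩

theorem Params.exists_materialLaw_ε (P : Params) : ∃ M L, MaterialLaw P.ε M L :=
  ⟨_, _, materialLaw_truncPow P.p P.εₘ (P.ε₀ - P.εₘ)⟩

/-- Certifies that the `derivWithin` behind `dirDeriv` is a genuine limit here and not the default
value 0. -/
theorem MaterialLaw.tendsto_dirDeriv {f : ℝ → ℝ} {M L : ℝ} (hf : MaterialLaw f M L) (a b : ℝ) :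
    Tendsto (fun t => (f (a + t * b) - f a) / t) (𝓝[>] 0) (𝓝 (dirDeriv f a b)) := by
  have h := (hf.diff a b).hasDerivWithinAt.Ioi_of_Ici
  rw [hasDerivWithinAt_iff_tendsto_slope' self_notMem_Ioi] at h
  simpa [slope_fun_def_field, dirDeriv] using h

/-- When b = 0 the quotient vanishes identically and the factor b kills `deriv f a`, whatever its
value; otherwise this is the chain rule. -/
theorem tendsto_quotient_of_differentiableAt {f : ℝ → ℝ} {a b : ℝ}
    (h : b = 0 ∨ DifferentiableAt ℝ f a) :
    Tendsto (fun t => (f (a + t * b) - f a) / t) (𝓝[≠] 0) (𝓝 (deriv f a * b)) := by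
  rcases h with rfl | h
  · simp
  · have h1 : HasDerivAt (fun t : ℝ => a + t * b) b 0 := by
      simpa using ((hasDerivAt_id (0 : ℝ)).mul_const b).const_add a
    have h2 : HasDerivAt f (deriv f a) (a + 0 * b) := by simpa using h.hasDerivAt
    have h3 := h2.comp (0 : ℝ) h1
    rw [hasDerivAt_iff_tendsto_slope] at h3
    simpa [slope_fun_def_field, Function.comp_def] using h3

/-! ### Convergence of integrals -/

section Integrals

variable {α : Type*} [MeasurableSpace α] {μ : Measure α}
  {F : Type*} [NormedAddCommGroup F] [InnerProductSpace ℝ F]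

/-- All the functions `f n` and `f₀` are integrable, and `∫ f n → ∫ f₀`. -/
structure IntegralsTendsto (μ : Measure α) (f : ℕ → α → ℝ) (f₀ : α → ℝ) : Prop where
  integrable : ∀ n, Integrable (f n) μ
  integrable_lim : Integrable f₀ μ
  tendsto : Tendsto (fun n => ∫ x, f n x ∂μ) atTop (𝓝 (∫ x, f₀ x ∂μ))

theorem IntegralsTendsto.add {f g : ℕ → α → ℝ} {f₀ g₀ : α → ℝ} (hf : IntegralsTendsto μ f f₀)
    (hg : IntegralsTendsto μ g g₀) :
    IntegralsTendsto μ (fun n x => f n x + g n x) (fun x => f₀ x + g₀ x) where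
  integrable n := (hf.integrable n).add (hg.integrable n)
  integrable_lim := hf.integrable_lim.add hg.integrable_lim
  tendsto := by
    rw [integral_add hf.integrable_lim hg.integrable_lim]
    simp_rw [fun n => integral_add (hf.integrable n) (hg.integrable n)]
    exact hf.tendsto.add hg.tendsto

theorem IntegralsTendsto.const_mul {f : ℕ → α → ℝ} {f₀ : α → ℝ} (hf : IntegralsTendsto μ f f₀)
    (k : ℝ) : IntegralsTendsto μ (fun n x => k * f n x) (fun x => k * f₀ x) where
  integrable n := (hf.integrable n).const_mul k
  integrable_lim := hf.integrable_lim.const_mul k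
  tendsto := by
    simp_rw [integral_const_mul]
    exact hf.tendsto.const_mul k

theorem IntegralsTendsto.congr {f g : ℕ → α → ℝ} {f₀ g₀ : α → ℝ} (hf : IntegralsTendsto μ f f₀)
    (h : ∀ n x, f n x = g n x) (h₀ : ∀ x, f₀ x = g₀ x) : IntegralsTendsto μ g g₀ := by
  have e : f = g := funext fun n => funext (h n)
  have e₀ : f₀ = g₀ := funext h₀
  rwa [← e, ← e₀]

/-- Dominated convergence for `k n * h`, with weights `|k n| ≤ M |θ|` and `θ * h` integrable. -/
theorem integralsTendsto_weight {k : ℕ → α → ℝ} {k₀ θ h : α → ℝ} {M : ℝ}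
    (hk : ∀ n, AEStronglyMeasurable (k n) μ) (hb : ∀ n, ∀ᵐ x ∂μ, |k n x| ≤ M * |θ x|)
    (hlim : ∀ᵐ x ∂μ, Tendsto (fun n => k n x) atTop (𝓝 (k₀ x)))
    (hh : AEStronglyMeasurable h μ) (hθ : Integrable (fun x => θ x * h x) μ) :
    IntegralsTendsto μ (fun n x => k n x * h x) (fun x => k₀ x * h x) := by
  -- The limit weight, later a directional derivative of a material law, gets its measurability from
  -- being an a.e. limit.
  have hk₀ : AEStronglyMeasurable k₀ μ := aestronglyMeasurable_of_tendsto_ae atTop hk hlim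
  have hbound : Integrable (fun x => M * ‖θ x * h x‖) μ := hθ.norm.const_mul M
  have hn : ∀ n, ∀ᵐ x ∂μ, ‖k n x * h x‖ ≤ M * ‖θ x * h x‖ := fun n => by
    filter_upwards [hb n] with x hx
    rw [norm_mul, norm_mul, ← mul_assoc]
    exact mul_le_mul_of_nonneg_right hx (norm_nonneg _)
  have h₀ : ∀ᵐ x ∂μ, ‖k₀ x * h x‖ ≤ M * ‖θ x * h x‖ := by
    filter_upwards [hlim, ae_all_iff.2 hn] with x hx hx'
    exact le_of_tendsto (hx.mul_const (h x)).norm (Eventually.of_forall hx')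
  exact ⟨fun n => hbound.mono' ((hk n).mul hh) (hn n), hbound.mono' (hk₀.mul hh) h₀,
    tendsto_integral_of_dominated_convergence _ (fun n => (hk n).mul hh) hbound hn
      (hlim.mono fun x hx => hx.mul_const (h x))⟩

theorem integrable_inner_of_memLp {G H : α → F} (hG : MemLp G 2 μ) (hH : MemLp H 2 μ) :
    Integrable (fun x => inner ℝ (G x) (H x)) μ :=
  (hG.norm.integrable_mul hH.norm).mono' (hG.1.inner hH.1)
    (Eventually.of_forall fun x => norm_inner_le_norm (G x) (H x))

/-- If `u n → 0` boundedly almost everywhere and `G n` is bounded in `L²`, then `u n ⟪G n, H⟫`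
tends to `0` in mean for every `H ∈ L²`. -/
theorem integralsTendsto_zero {u : ℕ → α → ℝ} {G : ℕ → α → F} {H : α → F} {M K : ℝ}
    (hu : ∀ n, AEStronglyMeasurable (u n) μ) (hb : ∀ n, ∀ᵐ x ∂μ, |u n x| ≤ M)
    (hlim : ∀ᵐ x ∂μ, Tendsto (fun n => u n x) atTop (𝓝 0))
    (hG : ∀ n, MemLp (G n) 2 μ) (hK : ∀ n, ∫ x, ‖G n x‖ ^ 2 ∂μ ≤ K) (hH : MemLp H 2 μ) :
    IntegralsTendsto μ (fun n x => u n x * inner ℝ (G n x) (H x)) (fun _ => 0) := by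
  have hH2 : Integrable (fun x => ‖H x‖ ^ 2) μ := hH.norm.integrable_sq
  have huH : ∀ n, MemLp (fun x => |u n x| * ‖H x‖) 2 μ := fun n => by
    refine (hH.norm.const_mul M).of_le_mul (c := 1) ((hu n).norm.mul hH.1.norm) ?_
    filter_upwards [hb n] with x hx
    have hM : 0 ≤ M := (abs_nonneg _).trans hx
    rw [one_mul, norm_mul, norm_mul, Real.norm_eq_abs, abs_abs, Real.norm_of_nonneg hM]
    gcongr
  -- Dominated convergence with majorant M²‖H‖².
  have hsq : IntegralsTendsto μ (fun n x => u n x ^ 2 * ‖H x‖ ^ 2) (fun x => 0 * ‖H x‖ ^ 2) := by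
    refine integralsTendsto_weight (θ := fun _ => 1) (M := M ^ 2) (fun n => (hu n).pow 2)
      (fun n => ?_) ?_ hH2.1 (by simpa using hH2)
    · filter_upwards [hb n] with x hx
      rw [abs_pow, abs_one, mul_one]
      gcongr
    · filter_upwards [hlim] with x hx
      simpa using hx.pow 2
  have hsq' : Tendsto (fun n => ∫ x, u n x ^ 2 * ‖H x‖ ^ 2 ∂μ) atTop (𝓝 0) := by
    simpa using hsq.tendsto
  have hint : ∀ n, Integrable (fun x => ‖G n x‖ * (|u n x| * ‖H x‖)) μ := fun n =>
    (hG n).norm.integrable_mul (huH n)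
  have hle : ∀ n x, ‖u n x * inner ℝ (G n x) (H x)‖ ≤ ‖G n x‖ * (|u n x| * ‖H x‖) :=
    fun n x => by
      rw [norm_mul, Real.norm_eq_abs (u n x), mul_left_comm]
      exact mul_le_mul_of_nonneg_left (norm_inner_le_norm _ _) (abs_nonneg _)
  -- Cauchy–Schwarz puts the small factor u n with the fixed H, so mere boundedness of G n is
  -- enough.
  have key : ∀ n, ‖∫ x, u n x * inner ℝ (G n x) (H x) ∂μ‖ ≤
      √K * √(∫ x, u n x ^ 2 * ‖H x‖ ^ 2 ∂μ) := fun n => by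
    have hCS := integral_mul_le_Lp_mul_Lq_of_nonneg (μ := μ) Real.HolderConjugate.two_two
      (f := fun x => ‖G n x‖) (g := fun x => |u n x| * ‖H x‖)
      (Eventually.of_forall fun x => norm_nonneg _)
      (Eventually.of_forall fun x => mul_nonneg (abs_nonneg _) (norm_nonneg _))
      (by simpa using (hG n).norm) (by simpa using huH n)
    simp only [Real.rpow_two, ← Real.sqrt_eq_rpow, mul_pow, sq_abs] at hCS
    refine (norm_integral_le_of_norm_le (hint n) (Eventually.of_forall (hle n))).trans
      (hCS.trans ?_)
    gcongr
    exact hK n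
  refine ⟨fun n => (hint n).mono' ((hu n).mul ((hG n).1.inner hH.1))
    (Eventually.of_forall (hle n)), integrable_zero _ _ _, ?_⟩
  rw [integral_zero]
  refine squeeze_zero_norm key ?_
  simpa using ((Real.continuous_sqrt.tendsto 0).comp hsq').const_mul √K

end Integrals

/-! ### The Sobolev space -/

section Sobolev

variable {d : ℕ} {Ω : Set (E d)}

theorem H1.memLp_fn (u : H1 Ω) : MemLp u.fn 2 (volume.restrict Ω) := u.2.1

theorem H1.memLp_grad (u : H1 Ω) : MemLp u.grad 2 (volume.restrict Ω) := u.2.2.1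

@[simp] theorem H1.fn_add (u v : H1 Ω) (x : E d) : (u + v).fn x = u.fn x + v.fn x := rfl

@[simp] theorem H1.fn_sub (u v : H1 Ω) (x : E d) : (u - v).fn x = u.fn x - v.fn x := rfl

@[simp] theorem H1.fn_smul (t : ℝ) (u : H1 Ω) (x : E d) : (t • u).fn x = t * u.fn x := rfl

@[simp] theorem H1.grad_add (u v : H1 Ω) (x : E d) : (u + v).grad x = u.grad x + v.grad x := rfl

@[simp] theorem H1.grad_sub (u v : H1 Ω) (x : E d) : (u - v).grad x = u.grad x - v.grad x := rfl

@[simp] theorem H1.grad_smul (t : ℝ) (u : H1 Ω) (x : E d) : (t • u).grad x = t • u.grad x := rfl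

theorem H1.norm_nonneg (u : H1 Ω) : 0 ≤ u.norm := Real.sqrt_nonneg _

theorem H1.norm_sq (u : H1 Ω) :
    u.norm ^ 2 = (∫ x in Ω, u.fn x ^ 2) + ∫ x in Ω, ‖u.grad x‖ ^ 2 :=
  Real.sq_sqrt (add_nonneg (integral_nonneg fun _ => sq_nonneg _)
    (integral_nonneg fun _ => sq_nonneg _))

theorem H1.integral_norm_grad_sq_le (u : H1 Ω) : ∫ x in Ω, ‖u.grad x‖ ^ 2 ≤ u.norm ^ 2 := by
  have h : 0 ≤ ∫ x in Ω, u.fn x ^ 2 := integral_nonneg fun _ => sq_nonneg _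
  rw [u.norm_sq]
  linarith

/-- Links the explicit H¹ norm to `eLpNorm`, from which convergence in measure is obtained. -/
theorem H1.eLpNorm_fn_le (u : H1 Ω) :
    eLpNorm u.fn 2 (volume.restrict Ω) ≤ ENNReal.ofReal u.norm := by
  rw [u.memLp_fn.eLpNorm_eq_integral_rpow_norm two_ne_zero ENNReal.ofNat_ne_top]
  refine ENNReal.ofReal_le_ofReal ?_
  have h : 0 ≤ ∫ x in Ω, ‖u.grad x‖ ^ 2 := integral_nonneg fun _ => sq_nonneg _
  simp only [ENNReal.toReal_ofNat, Real.rpow_two, Real.norm_eq_abs, sq_abs, H1.norm]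
  rw [← one_div, ← Real.sqrt_eq_rpow]
  exact Real.sqrt_le_sqrt (by linarith)

theorem tendsto_eLpNorm_sub_sub {α F : Type*} [MeasurableSpace α] [NormedAddCommGroup F]
    {μ : Measure α} {f g : ℕ → α → F} {f₀ g₀ : α → F}
    (hf : ∀ n, AEStronglyMeasurable (fun x => f n x - f₀ x) μ)
    (hg : ∀ n, AEStronglyMeasurable (fun x => g n x - g₀ x) μ)
    (hf' : Tendsto (fun n => eLpNorm (fun x => f n x - f₀ x) 2 μ) atTop (𝓝 0))
    (hg' : Tendsto (fun n => eLpNorm (fun x => g n x - g₀ x) 2 μ) atTop (𝓝 0)) :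
    Tendsto (fun n => eLpNorm (fun x => (f n x - g n x) - (f₀ x - g₀ x)) 2 μ) atTop (𝓝 0) := by
  have hfg := hf'.add hg'
  rw [add_zero] at hfg
  refine tendsto_of_tendsto_of_tendsto_of_le_of_le tendsto_const_nhds hfg (fun _ => zero_le)
    fun n => ?_
  have e : (fun x => (f n x - g n x) - (f₀ x - g₀ x)) =
      (fun x => f n x - f₀ x) - fun x => g n x - g₀ x := by
    ext x
    simp only [Pi.sub_apply]
    abel
  rw [e]
  exact eLpNorm_sub_le (hf n) (hg n) one_le_two

theorem continuous_gradient {v : E d → ℝ} (h : ContDiff ℝ ∞ v) : Continuous (gradient v) :=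
  (InnerProductSpace.toDual ℝ (E d)).symm.continuous.comp (h.continuous_fderiv (by simp))

theorem gradient_sub {v w : E d → ℝ} (hv : ContDiff ℝ ∞ v) (hw : ContDiff ℝ ∞ w) (x : E d) :
    gradient (fun y => v y - w y) x = gradient v x - gradient w x := by
  have h := fderiv_fun_sub (𝕜 := ℝ) (hv.differentiable (by simp) x)
    (hw.differentiable (by simp) x)
  simp only [gradient, h, map_sub]

/-- Subtract the approximating smooth sequences. -/
theorem HasTrace.sub {u w : H1 Ω} {h k : E d → ℝ} (hu : HasTrace u h) (hw : HasTrace w k) :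
    HasTrace (u - w) (fun x => h x - k x) := by
  obtain ⟨hh, v, hv, hv1, hv2, hv3⟩ := hu
  obtain ⟨hk, y, hy, hy1, hy2, hy3⟩ := hw
  refine ⟨hh.sub hk, fun n x => v n x - y n x, fun n => (hv n).sub (hy n), ?_, ?_, ?_⟩
  · exact tendsto_eLpNorm_sub_sub
      (fun n => (hv n).continuous.aestronglyMeasurable.sub u.memLp_fn.1)
      (fun n => (hy n).continuous.aestronglyMeasurable.sub w.memLp_fn.1) hv1 hy1
  · simp_rw [fun n => gradient_sub (hv n) (hy n)]
    exact tendsto_eLpNorm_sub_sub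
      (fun n => (continuous_gradient (hv n)).aestronglyMeasurable.sub u.memLp_grad.1)
      (fun n => (continuous_gradient (hy n)).aestronglyMeasurable.sub w.memLp_grad.1) hv2 hy2
  · exact tendsto_eLpNorm_sub_sub
      (fun n => (hv n).continuous.aestronglyMeasurable.sub hh.1)
      (fun n => (hy n).continuous.aestronglyMeasurable.sub hk.1) hv3 hy3

theorem ZeroOn.sub {Γ : Set (E d)} {u w : H1 Ω} (hu : ZeroOn Γ u) (hw : ZeroOn Γ w) :
    ZeroOn Γ (u - w) := by
  obtain ⟨h, hh, h0⟩ := hu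
  obtain ⟨k, hk, k0⟩ := hw
  refine ⟨_, hh.sub hk, ?_⟩
  filter_upwards [h0, k0] with x hx kx hΓ
  rw [hx hΓ, kx hΓ, sub_zero]

/-- Two states with the same Dirichlet data differ by an admissible test function for the adjoint
system. -/
theorem ZeroOn.sub_of_sub {Γ : Set (E d)} {u w g : H1 Ω} (hu : ZeroOn Γ (u - g))
    (hw : ZeroOn Γ (w - g)) : ZeroOn Γ (u - w) := by
  simpa using hu.sub hw

end Sobolev

/-! ### The duality identity -/

/-- `f` is integrable with integral `a`. -/
def HasIntegralEq {α : Type*} [MeasurableSpace α] (μ : Measure α) (f : α → ℝ) (a : ℝ) : Prop :=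
  Integrable f μ ∧ ∫ x, f x ∂μ = a

theorem HasIntegralEq.add {α : Type*} [MeasurableSpace α] {μ : Measure α} {f g : α → ℝ} {a b : ℝ}
    (hf : HasIntegralEq μ f a) (hg : HasIntegralEq μ g b) :
    HasIntegralEq μ (fun x => f x + g x) (a + b) :=
  ⟨hf.1.add hg.1, by rw [integral_add hf.1 hg.1, hf.2, hg.2]⟩

theorem HasIntegralEq.sub {α : Type*} [MeasurableSpace α] {μ : Measure α} {f g : α → ℝ} {a b : ℝ}
    (hf : HasIntegralEq μ f a) (hg : HasIntegralEq μ g b) :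
    HasIntegralEq μ (fun x => f x - g x) (a - b) :=
  ⟨hf.1.sub hg.1, by rw [integral_sub hf.1 hg.1, hf.2, hg.2]⟩

theorem HasIntegralEq.sum {α ι : Type*} [Fintype ι] [MeasurableSpace α] {μ : Measure α}
    {f : ι → α → ℝ} {a : ι → ℝ} (hf : ∀ i, HasIntegralEq μ (f i) (a i)) :
    HasIntegralEq μ (fun x => ∑ i, f i x) (∑ i, a i) :=
  ⟨integrable_finsetSum _ fun i _ => (hf i).1, by
    rw [integral_finsetSum _ fun i _ => (hf i).1]
    exact Finset.sum_congr rfl fun i _ => (hf i).2⟩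

section Duality

variable {d : ℕ} {Ω : Set (E d)}

/-- The contribution of one species to the increment of the objective when the phase field changes
from `φ` to `φ + tθ` and the state from `(c, ψ)` to `(C, Ψ)`. -/
def speciesIncrement (P : Params) (zi : ℝ) (φ θ c ψ s : H1 Ω) (t : ℝ) (C Ψ : H1 Ω) (x : E d) : ℝ :=
  -((P.D ((φ + t • θ).fn x) - P.D (φ.fn x)) * inner ℝ (flux P zi (φ + t • θ) C Ψ x) (s.grad x))
    - P.D (φ.fn x) * zi * (C - c).fn x * inner ℝ ((Ψ - ψ).grad x) (s.grad x)
    + P.D (φ.fn x) * P.α₀ * C.fn x * (t * inner ℝ (θ.grad x) (s.grad x))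

/-- The contribution of the potential to the increment of the objective. -/
def potentialIncrement (P : Params) (φ θ ζ : H1 Ω) (t : ℝ) (Ψ : H1 Ω) (x : E d) : ℝ :=
  -((P.ε ((φ + t • θ).fn x) - P.ε (φ.fn x)) * inner ℝ (Ψ.grad x) (ζ.grad x))

theorem hasIntegralEq_J [IsFiniteMeasure (volume.restrict Ω)] (c : Fin 2 → H1 Ω) :
    HasIntegralEq (volume.restrict Ω) (fun x => -∑ i, z i * (c i).fn x) (J c) :=
  ⟨(integrable_finsetSum _ fun i _ =>
    ((c i).memLp_fn.integrable one_le_two).const_mul (z i)).neg, rfl⟩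

/-- The increment of the objective, computed by testing the state equations with the adjoint state
and the adjoint equations with the increment of the state. -/
theorem hasIntegralEq_increment [IsFiniteMeasure (volume.restrict Ω)] {P : Params}
    {Γ : Set (E d)} {cinf : Fin 2 → H1 Ω} {g φ θ ψ ζ Ψ : H1 Ω} {c s C : Fin 2 → H1 Ω} {t : ℝ}
    (hadj : IsAdjointSolution P Γ φ c ψ s ζ) (h₀ : IsPNPSolution P Γ cinf g φ c ψ)
    (h : IsPNPSolution P Γ cinf g (φ + t • θ) C Ψ) :
    HasIntegralEq (volume.restrict Ω)
      (fun x => (∑ i, speciesIncrement P (z i) φ θ (c i) ψ (s i) t (C i) Ψ x)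
        + potentialIncrement P φ θ ζ t Ψ x) (J C - J c) := by
  obtain ⟨hs, hζ, adj₁, adj₂⟩ := hadj
  obtain ⟨hc, hψ, np, po⟩ := h₀
  obtain ⟨hC, hΨ, NP, PO⟩ := h
  have hδc : ∀ i, ZeroOn Γ (C i - c i) := fun i => (hC i).sub_of_sub (hc i)
  have hδψ : ZeroOn Γ (Ψ - ψ) := hΨ.sub_of_sub hψ
  obtain ⟨a1, a2, a3⟩ := adj₂ _ hδψ
  have A₂ := HasIntegralEq.add (μ := volume.restrict Ω) ⟨a1, rfl⟩
    (HasIntegralEq.sum fun i => ⟨a2 i, rfl⟩)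
  rw [a3] at A₂
  have A₁ := HasIntegralEq.sum (μ := volume.restrict Ω) fun i => adj₁ i _ (hδc i)
  have S := HasIntegralEq.sum (μ := volume.restrict Ω) fun i =>
    HasIntegralEq.sub (NP i _ (hs i)) (np i _ (hs i))
  have Q := HasIntegralEq.sub (μ := volume.restrict Ω) (PO ζ hζ) (po ζ hζ)
  -- Every summand but the first two has integral 0. Combining whole integrands, whose integrability
  -- is part of the weak formulations, avoids splitting products that need not be integrable
  -- separately.
  have T := (((((hasIntegralEq_J C).sub (hasIntegralEq_J c)).add A₁).add A₂).sub S).sub Q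
  convert T using 1
  · ext x
    simp only [Fin.sum_univ_two, speciesIncrement, potentialIncrement, flux, H1.fn_add, H1.fn_sub,
      H1.fn_smul, H1.grad_add, H1.grad_sub, H1.grad_smul, inner_add_left, inner_sub_left,
      inner_add_right, inner_sub_right, real_inner_smul_left, real_inner_smul_right, smul_add]
    simp only [real_inner_comm]
    ring
  · simp

end Duality

/-! ### Convergence of the increments -/

section Convergence

variable {d : ℕ} {Ω : Set (E d)}

/-- Used with G = ∇φ: this is where the bound on the gradient of the phase field enters. -/
theorem H1.integrable_mul_inner_of_memLp_top {θ s : H1 Ω} {G : E d → E d}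
    (hG : MemLp G ⊤ (volume.restrict Ω)) :
    Integrable (fun x => θ.fn x * inner ℝ (G x) (s.grad x)) (volume.restrict Ω) := by
  have h : MemLp (fun x => inner ℝ (G x) (s.grad x)) 2 (volume.restrict Ω) := by
    have h' : MemLp (fun x => ‖G x‖ * ‖s.grad x‖) 2 (volume.restrict Ω) :=
      s.memLp_grad.norm.mul' hG.norm
    refine h'.of_le (hG.1.inner s.memLp_grad.1) (Eventually.of_forall fun x => ?_)
    rw [norm_mul, norm_norm, norm_norm]
    exact norm_inner_le_norm _ _
  exact θ.memLp_fn.integrable_mul h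

/-- Turns the O(t) hypothesis on a state increment u into the uniform L² bound required by
`integralsTendsto_zero`. -/
theorem H1.integral_norm_grad_sq_inv_smul_le {u : H1 Ω} {t K : ℝ} (ht : t ≠ 0)
    (h : u.norm ≤ K * |t|) : ∫ x in Ω, ‖(t⁻¹ • u).grad x‖ ^ 2 ≤ K ^ 2 := by
  have e : ∫ x in Ω, ‖(t⁻¹ • u).grad x‖ ^ 2 = (t ^ 2)⁻¹ * ∫ x in Ω, ‖u.grad x‖ ^ 2 := by
    rw [← integral_const_mul]
    congr 1 with x
    rw [H1.grad_smul, norm_smul, mul_pow, Real.norm_eq_abs, sq_abs, inv_pow]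
  have ht2 : 0 < t ^ 2 := by positivity
  rw [e, inv_mul_le_iff₀ ht2]
  calc _ ≤ u.norm ^ 2 := u.integral_norm_grad_sq_le
    _ ≤ (K * |t|) ^ 2 := pow_le_pow_left₀ u.norm_nonneg h 2
    _ = t ^ 2 * K ^ 2 := by rw [mul_pow, sq_abs, mul_comm]

theorem MaterialLaw.aestronglyMeasurable {f : ℝ → ℝ} {M L : ℝ} (hf : MaterialLaw f M L)
    (u : H1 Ω) : AEStronglyMeasurable (fun x => f (u.fn x)) (volume.restrict Ω) :=
  hf.continuous.comp_aestronglyMeasurable u.memLp_fn.1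

theorem MaterialLaw.abs_quotient_le {f : ℝ → ℝ} {M L : ℝ} (hf : MaterialLaw f M L) {t : ℝ}
    (ht : t ≠ 0) (a b : ℝ) : |(f (a + t * b) - f a) / t| ≤ L * |b| := by
  rw [abs_div, div_le_iff₀ (abs_pos.2 ht)]
  have h := hf.abs_sub_le (a + t * b) a
  rw [add_sub_cancel_left, abs_mul] at h
  linarith

theorem MaterialLaw.lipschitz_nonneg {f : ℝ → ℝ} {M L : ℝ} (hf : MaterialLaw f M L) : 0 ≤ L := by
  have h := (abs_nonneg _).trans (hf.abs_sub_le 1 0)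
  simpa using h

theorem MaterialLaw.abs_sub_le_two {f : ℝ → ℝ} {M L : ℝ} (hf : MaterialLaw f M L) (a b : ℝ) :
    |f a - f b| ≤ 2 * M := by
  have h := abs_sub (f a) (f b)
  linarith [hf.abs_le a, hf.abs_le b]

theorem MaterialLaw.tendsto_comp {f : ℝ → ℝ} {M L : ℝ} (hf : MaterialLaw f M L) {t : ℕ → ℝ}
    (ht : Tendsto t atTop (𝓝 0)) (a b : ℝ) :
    Tendsto (fun n => f (a + t n * b)) atTop (𝓝 (f a)) := by
  have h : Tendsto (fun n => a + t n * b) atTop (𝓝 a) := by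
    simpa using (ht.mul_const b).const_add a
  exact (hf.continuous.tendsto a).comp h

theorem MaterialLaw.tendsto_sub {f : ℝ → ℝ} {M L : ℝ} (hf : MaterialLaw f M L) {t : ℕ → ℝ}
    (ht : Tendsto t atTop (𝓝 0)) (a b : ℝ) :
    Tendsto (fun n => f (a + t n * b) - f a) atTop (𝓝 0) := by
  simpa using (hf.tendsto_comp ht a b).sub_const (f a)

/-- Split ∇Ψ = ∇ψ + ∇(Ψ - ψ). The first part has a dominated difference quotient as weight; in the
second, 1/t goes to the gradient and the increment of ε tends to 0. -/
theorem potentialIncrement_tendsto {P : Params} {φ θ ψ ζ : H1 Ω} {t : ℕ → ℝ} {Ψ : ℕ → H1 Ω}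
    {dε : E d → ℝ} {K : ℝ} (ht0 : ∀ n, t n ≠ 0) (ht : Tendsto t atTop (𝓝 0))
    (hKψ : ∀ n, (Ψ n - ψ).norm ≤ K * |t n|)
    (hdε : ∀ᵐ x ∂(volume.restrict Ω), Tendsto
      (fun n => (P.ε (φ.fn x + t n * θ.fn x) - P.ε (φ.fn x)) / t n) atTop (𝓝 (dε x)))
    (hθζ : IntegrableOn (fun x => θ.fn x * inner ℝ (ψ.grad x) (ζ.grad x)) Ω) :
    IntegralsTendsto (volume.restrict Ω)
      (fun n x => (t n)⁻¹ * potentialIncrement P φ θ ζ (t n) (Ψ n) x)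
      (fun x => -(dε x * inner ℝ (ψ.grad x) (ζ.grad x))) := by
  obtain ⟨M, L, hε⟩ := P.exists_materialLaw_ε
  have m : ∀ n, AEStronglyMeasurable (fun x => P.ε ((φ + t n • θ).fn x) - P.ε (φ.fn x))
      (volume.restrict Ω) := fun n =>
    (hε.aestronglyMeasurable _).sub (hε.aestronglyMeasurable φ)
  have V₁ := integralsTendsto_weight (μ := volume.restrict Ω)
    (k := fun n x => (P.ε ((φ + t n • θ).fn x) - P.ε (φ.fn x)) / t n) (M := L)
    (fun n => (m n).mul aestronglyMeasurable_const (g := fun _ => (t n)⁻¹))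
    (fun n => Eventually.of_forall fun x => hε.abs_quotient_le (ht0 n) _ _) hdε
    (ψ.memLp_grad.1.inner ζ.memLp_grad.1) hθζ
  have V₂ := integralsTendsto_zero (μ := volume.restrict Ω)
    (G := fun n => ((t n)⁻¹ • (Ψ n - ψ)).grad) m
    (fun n => Eventually.of_forall fun x => hε.abs_sub_le_two _ _)
    (Eventually.of_forall fun x => hε.tendsto_sub ht _ _) (fun n => H1.memLp_grad _)
    (fun n => H1.integral_norm_grad_sq_inv_smul_le (ht0 n) (hKψ n)) ζ.memLp_grad
  refine ((V₁.add V₂).const_mul (-1)).congr (fun n x => ?_) (fun x => by ring)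
  simp only [potentialIncrement, H1.grad_smul, H1.grad_sub, real_inner_smul_left, inner_sub_left]
  ring

/-- In the flux only the gradients of C and Ψ are split into base value and increment; the factor C
stays whole, being bounded and a.e. convergent. -/
theorem speciesIncrement_tendsto {P : Params} {φ θ c ψ s : H1 Ω} {t : ℕ → ℝ} {C Ψ : ℕ → H1 Ω}
    {dD : E d → ℝ} {zi K M : ℝ} (ht0 : ∀ n, t n ≠ 0) (ht : Tendsto t atTop (𝓝 0))
    (hφ : φ.MemW1Inf) (hM : ∀ n, ∀ᵐ x ∂(volume.restrict Ω), |(C n).fn x| ≤ M)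
    (hM₀ : ∀ᵐ x ∂(volume.restrict Ω), |c.fn x| ≤ M)
    (hlim : ∀ᵐ x ∂(volume.restrict Ω), Tendsto (fun n => (C n).fn x) atTop (𝓝 (c.fn x)))
    (hKc : ∀ n, (C n - c).norm ≤ K * |t n|) (hKψ : ∀ n, (Ψ n - ψ).norm ≤ K * |t n|)
    (hdD : ∀ᵐ x ∂(volume.restrict Ω), Tendsto
      (fun n => (P.D (φ.fn x + t n * θ.fn x) - P.D (φ.fn x)) / t n) atTop (𝓝 (dD x)))
    (hθc : IntegrableOn (fun x => θ.fn x * inner ℝ (c.grad x) (s.grad x)) Ω)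
    (hθψ : IntegrableOn (fun x => θ.fn x * inner ℝ (ψ.grad x) (s.grad x)) Ω) :
    IntegralsTendsto (volume.restrict Ω)
      (fun n x => (t n)⁻¹ * speciesIncrement P zi φ θ c ψ s (t n) (C n) (Ψ n) x)
      (fun x => -(dD x * inner ℝ (flux P zi φ c ψ x) (s.grad x))
        + P.D (φ.fn x) * P.α₀ * c.fn x * inner ℝ (θ.grad x) (s.grad x)) ∧
    IntegrableOn (fun x => dD x * inner ℝ (flux P zi φ c ψ x) (s.grad x)) Ω ∧
    IntegrableOn (fun x => P.D (φ.fn x) * P.α₀ * c.fn x * inner ℝ (θ.grad x) (s.grad x)) Ω := by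
  obtain ⟨N, L, hD⟩ := P.exists_materialLaw_D
  have hN : 0 ≤ N := (abs_nonneg _).trans (hD.abs_le 0)
  have hL := hD.lipschitz_nonneg
  have mC : ∀ n, AEStronglyMeasurable (C n).fn (volume.restrict Ω) := fun n => (C n).memLp_fn.1
  have mD : ∀ n, AEStronglyMeasurable (fun x => P.D ((φ + t n • θ).fn x)) (volume.restrict Ω) :=
    fun n => hD.aestronglyMeasurable _
  have mδ : ∀ n, AEStronglyMeasurable (fun x => P.D ((φ + t n • θ).fn x) - P.D (φ.fn x))
      (volume.restrict Ω) := fun n => (mD n).sub (hD.aestronglyMeasurable φ)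
  have mq : ∀ n, AEStronglyMeasurable
      (fun x => (P.D ((φ + t n • θ).fn x) - P.D (φ.fn x)) / t n) (volume.restrict Ω) := fun n =>
    (mδ n).mul aestronglyMeasurable_const (g := fun _ => (t n)⁻¹)
  have bq : ∀ n, ∀ᵐ x ∂(volume.restrict Ω),
      |(P.D ((φ + t n • θ).fn x) - P.D (φ.fn x)) / t n * (C n).fn x| ≤ L * M * |θ.fn x| :=
    fun n => by
      filter_upwards [hM n] with x hx
      rw [abs_mul, mul_right_comm]
      exact mul_le_mul (hD.abs_quotient_le (ht0 n) _ _) hx (abs_nonneg _) (by positivity)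
  have limq : ∀ᵐ x ∂(volume.restrict Ω), Tendsto
      (fun n => (P.D ((φ + t n • θ).fn x) - P.D (φ.fn x)) / t n * (C n).fn x) atTop
      (𝓝 (dD x * c.fn x)) := by
    filter_upwards [hdD, hlim] with x h1 h2 using h1.mul h2
  have V₁ := integralsTendsto_weight (μ := volume.restrict Ω) (M := L) mq
    (fun n => Eventually.of_forall fun x => hD.abs_quotient_le (ht0 n) _ _) hdD
    (c.memLp_grad.1.inner s.memLp_grad.1) hθc
  have V₂ := integralsTendsto_weight (μ := volume.restrict Ω) (fun n => (mq n).mul (mC n)) bq limq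
    (ψ.memLp_grad.1.inner s.memLp_grad.1) hθψ
  have V₃ := integralsTendsto_weight (μ := volume.restrict Ω) (fun n => (mq n).mul (mC n)) bq limq
    (φ.memLp_grad.1.inner s.memLp_grad.1) (H1.integrable_mul_inner_of_memLp_top hφ.2)
  have V₄ := integralsTendsto_weight (μ := volume.restrict Ω) (θ := fun _ => 1)
    (k := fun n x => P.D ((φ + t n • θ).fn x) * (C n).fn x)
    (k₀ := fun x => P.D (φ.fn x) * c.fn x) (M := N * M) (fun n => (mD n).mul (mC n))
    (fun n => by
      filter_upwards [hM n] with x hx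
      rw [abs_mul, abs_one, mul_one]
      exact mul_le_mul (hD.abs_le _) hx (abs_nonneg _) hN)
    (by filter_upwards [hlim] with x hx using (hD.tendsto_comp ht _ _).mul hx)
    (θ.memLp_grad.1.inner s.memLp_grad.1)
    (by simpa using integrable_inner_of_memLp θ.memLp_grad s.memLp_grad)
  have V₅ := integralsTendsto_zero (μ := volume.restrict Ω)
    (G := fun n => ((t n)⁻¹ • (C n - c)).grad) mδ
    (fun n => Eventually.of_forall fun x => hD.abs_sub_le_two _ _)
    (Eventually.of_forall fun x => hD.tendsto_sub ht _ _) (fun n => H1.memLp_grad _)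
    (fun n => H1.integral_norm_grad_sq_inv_smul_le (ht0 n) (hKc n)) s.memLp_grad
  have V₆ := integralsTendsto_zero (μ := volume.restrict Ω) (M := 2 * N * M)
    (G := fun n => ((t n)⁻¹ • (Ψ n - ψ)).grad) (fun n => (mδ n).mul (mC n))
    (fun n => by
      filter_upwards [hM n] with x hx
      simp only [Pi.mul_apply]
      rw [abs_mul]
      exact mul_le_mul (hD.abs_sub_le_two _ _) hx (abs_nonneg _) (by positivity))
    (by
      filter_upwards [hlim] with x hx
      simpa using (hD.tendsto_sub ht (φ.fn x) (θ.fn x)).mul hx)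
    (fun n => H1.memLp_grad _)
    (fun n => H1.integral_norm_grad_sq_inv_smul_le (ht0 n) (hKψ n)) s.memLp_grad
  -- The quadratic remainder: 1/t is absorbed by Ψ - ψ, while C - c is bounded by 2M and tends to 0
  -- a.e.
  have V₇ := integralsTendsto_zero (μ := volume.restrict Ω) (M := N * (2 * M))
    (u := fun n x => P.D (φ.fn x) * (C n - c).fn x)
    (G := fun n => ((t n)⁻¹ • (Ψ n - ψ)).grad)
    (fun n => (hD.aestronglyMeasurable φ).mul (C n - c).memLp_fn.1)
    (fun n => by
      filter_upwards [hM n, hM₀] with x hx hx₀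
      rw [abs_mul, H1.fn_sub]
      refine mul_le_mul (hD.abs_le _) ?_ (abs_nonneg _) hN
      linarith [abs_sub ((C n).fn x) (c.fn x)])
    (by
      filter_upwards [hlim] with x hx
      simpa using (hx.sub_const (c.fn x)).const_mul (P.D (φ.fn x)))
    (fun n => H1.memLp_grad _)
    (fun n => H1.integral_norm_grad_sq_inv_smul_le (ht0 n) (hKψ n)) s.memLp_grad
  -- `W₁` yields the term with `dD`, `W₂` the term with ∇θ, and `W₃` collects the errors with limit
  -- 0. The term t∇θ in the gradient of the phase field lets `W₂` carry D(φ + tθ) instead of D(φ).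
  have W₁ := (V₁.add (V₂.const_mul zi)).add (V₃.const_mul (-P.α₀))
  have W₂ := V₄.const_mul P.α₀
  have W₃ := (V₅.add (V₆.const_mul zi)).add (V₇.const_mul zi)
  have e₁ : ∀ x, dD x * inner ℝ (c.grad x) (s.grad x)
      + zi * (dD x * c.fn x * inner ℝ (ψ.grad x) (s.grad x))
      + -P.α₀ * (dD x * c.fn x * inner ℝ (φ.grad x) (s.grad x))
      = dD x * inner ℝ (flux P zi φ c ψ x) (s.grad x) := fun x => by
    simp only [flux, inner_add_left, inner_sub_left, real_inner_smul_left]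
    ring
  have e₂ : ∀ x, P.α₀ * (P.D (φ.fn x) * c.fn x * inner ℝ (θ.grad x) (s.grad x))
      = P.D (φ.fn x) * P.α₀ * c.fn x * inner ℝ (θ.grad x) (s.grad x) := fun x => by ring
  refine ⟨((W₁.const_mul (-1)).add (W₂.add (W₃.const_mul (-1)))).congr (fun n x => ?_)
    (fun x => ?_), W₁.integrable_lim.congr (Eventually.of_forall e₁),
    W₂.integrable_lim.congr (Eventually.of_forall e₂)⟩
  · have := ht0 n
    simp only [speciesIncrement, flux, H1.grad_smul, H1.grad_sub, H1.grad_add, H1.fn_sub,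
      real_inner_smul_left, inner_sub_left, inner_add_left, Pi.mul_apply, smul_add]
    field_simp
    ring
  · rw [← e₁, ← e₂]
    ring

end Convergence

/-! ### The sensitivity formula -/

section Sensitivity

variable {d : ℕ} {Ω : Set (E d)}

/-- The sensitivity formula along a sequence of step sizes for which the concentrations converge
almost everywhere. -/
theorem sensitivity_of_seq [IsFiniteMeasure (volume.restrict Ω)] {P : Params} {Γ : Set (E d)}
    {cinf : Fin 2 → H1 Ω} {g φ θ ψ ζ : H1 Ω} {c s : Fin 2 → H1 Ω} {dD dε : E d → ℝ}
    {t : ℕ → ℝ} {C : ℕ → Fin 2 → H1 Ω} {Ψ : ℕ → H1 Ω} {K M : ℝ} (hφ : φ.MemW1Inf)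
    (hadj : IsAdjointSolution P Γ φ c ψ s ζ)
    (hθc : ∀ i, IntegrableOn (fun x => θ.fn x * inner ℝ ((c i).grad x) ((s i).grad x)) Ω)
    (hθψ : ∀ i, IntegrableOn (fun x => θ.fn x * inner ℝ (ψ.grad x) ((s i).grad x)) Ω)
    (hθζ : IntegrableOn (fun x => θ.fn x * inner ℝ (ψ.grad x) (ζ.grad x)) Ω)
    (ht0 : ∀ n, t n ≠ 0) (ht : Tendsto t atTop (𝓝 0))
    (h₀ : IsPNPSolution P Γ cinf g φ c ψ)
    (h : ∀ n, IsPNPSolution P Γ cinf g (φ + t n • θ) (C n) (Ψ n))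
    (hM : ∀ n i, ∀ᵐ x ∂(volume.restrict Ω), |(C n i).fn x| ≤ M)
    (hM₀ : ∀ i, ∀ᵐ x ∂(volume.restrict Ω), |(c i).fn x| ≤ M)
    (hlim : ∀ i, ∀ᵐ x ∂(volume.restrict Ω),
      Tendsto (fun n => (C n i).fn x) atTop (𝓝 ((c i).fn x)))
    (hKc : ∀ n i, (C n i - c i).norm ≤ K * |t n|) (hKψ : ∀ n, (Ψ n - ψ).norm ≤ K * |t n|)
    (hdD : ∀ᵐ x ∂(volume.restrict Ω), Tendsto
      (fun n => (P.D (φ.fn x + t n * θ.fn x) - P.D (φ.fn x)) / t n) atTop (𝓝 (dD x)))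
    (hdε : ∀ᵐ x ∂(volume.restrict Ω), Tendsto
      (fun n => (P.ε (φ.fn x + t n * θ.fn x) - P.ε (φ.fn x)) / t n) atTop (𝓝 (dε x))) :
    SensitivityIntegrable P φ θ dD dε c ψ s ζ ∧
      Tendsto (fun n => (t n)⁻¹ * (J (C n) - J c)) atTop
        (𝓝 (sensitivity P φ θ dD dε c ψ s ζ)) := by
  have S := fun i => speciesIncrement_tendsto (zi := z i) ht0 ht hφ (hM · i) (hM₀ i) (hlim i)
    (hKc · i) hKψ hdD (hθc i) (hθψ i)
  have Q := potentialIncrement_tendsto ht0 ht hKψ hdε hθζ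
  have hQ : IntegrableOn (fun x => dε x * inner ℝ (ψ.grad x) (ζ.grad x)) Ω := by
    simpa [IntegrableOn] using Q.integrable_lim.neg
  refine ⟨⟨fun i => (S i).2.1, hQ, fun i => (S i).2.2⟩, ?_⟩
  have T := ((S 0).1.add (S 1).1).add Q
  have hval := T.tendsto
  rw [integral_add ((S 0).1.add (S 1).1).integrable_lim Q.integrable_lim,
    integral_add (S 0).1.integrable_lim (S 1).1.integrable_lim,
    integral_add (S 0).2.1.fun_neg (S 0).2.2, integral_add (S 1).2.1.fun_neg (S 1).2.2] at hval
  simp only [integral_neg] at hval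
  convert hval using 2 with n
  · have I := hasIntegralEq_increment hadj h₀ (h n)
    rw [← I.2, ← integral_const_mul]
    congr 1 with x
    rw [Fin.sum_univ_two]
    ring
  · rw [sensitivity, Fin.sum_univ_two, Fin.sum_univ_two]
    ring

/-- A sequence converging in `H¹(Ω)` has a subsequence converging almost everywhere. -/
theorem H1.exists_subseq_tendsto_ae {u : ℕ → H1 Ω} {u₀ : H1 Ω}
    (h : Tendsto (fun n => (u n - u₀).norm) atTop (𝓝 0)) :
    ∃ ns : ℕ → ℕ, StrictMono ns ∧ ∀ᵐ x ∂(volume.restrict Ω),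
      Tendsto (fun n => (u (ns n)).fn x) atTop (𝓝 (u₀.fn x)) := by
  refine (tendstoInMeasure_of_tendsto_eLpNorm (p := 2) two_ne_zero
    (fun n => (u n).memLp_fn.1) u₀.memLp_fn.1 ?_).exists_seq_tendsto_ae
  have h' : Tendsto (fun n => ENNReal.ofReal (u n - u₀).norm) atTop (𝓝 0) := by
    simpa using ENNReal.tendsto_ofReal h
  exact tendsto_of_tendsto_of_tendsto_of_le_of_le tendsto_const_nhds h' (fun _ => zero_le)
    fun n => (u n - u₀).eLpNorm_fn_le

/-- The sensitivity formula along a filter of nonzero step sizes. -/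
theorem sensitivity_of_filter [IsFiniteMeasure (volume.restrict Ω)] {P : Params} {Γ : Set (E d)}
    {cinf : Fin 2 → H1 Ω} {g φ θ ζ : H1 Ω} {c : H1 Ω → Fin 2 → H1 Ω} {ψ : H1 Ω → H1 Ω}
    {s : Fin 2 → H1 Ω} {dD dε : E d → ℝ} {l l' : Filter ℝ} [l.NeBot] [l.IsCountablyGenerated]
    (hl : l ≤ 𝓝[≠] 0) (hll' : l ≤ l') (hpure : pure 0 ≤ l') (hφ : φ.MemW1Inf)
    (hadj : IsAdjointSolution P Γ φ (c φ) (ψ φ) s ζ)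
    (hθc : ∀ i, IntegrableOn (fun x => θ.fn x * inner ℝ ((c φ i).grad x) ((s i).grad x)) Ω)
    (hθψ : ∀ i, IntegrableOn (fun x => θ.fn x * inner ℝ ((ψ φ).grad x) ((s i).grad x)) Ω)
    (hθζ : IntegrableOn (fun x => θ.fn x * inner ℝ ((ψ φ).grad x) (ζ.grad x)) Ω)
    (hreg : RegularStateAlong P Γ cinf g c ψ φ θ l')
    (hdD : ∀ᵐ x ∂(volume.restrict Ω), Tendsto
      (fun t => (P.D (φ.fn x + t * θ.fn x) - P.D (φ.fn x)) / t) l (𝓝 (dD x)))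
    (hdε : ∀ᵐ x ∂(volume.restrict Ω), Tendsto
      (fun t => (P.ε (φ.fn x + t * θ.fn x) - P.ε (φ.fn x)) / t) l (𝓝 (dε x))) :
    SensitivityIntegrable P φ θ dD dε (c φ) (ψ φ) s ζ ∧
      Tendsto (slope (fun t : ℝ => J (c (φ + t • θ))) 0) l
        (𝓝 (sensitivity P φ θ dD dε (c φ) (ψ φ) s ζ)) := by
  obtain ⟨hsol, ⟨M, hM⟩, hOc, hOψ⟩ := hreg
  have hzero : φ + (0 : ℝ) • θ = φ := by simp
  -- Since `pure 0 ≤ l'`, what holds eventually along `l'` holds at t = 0; so the base state is a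
  -- solution and obeys the same bound M.
  have hsol₀ : IsPNPSolution P Γ cinf g φ (c φ) (ψ φ) := by
    have h : IsPNPSolution P Γ cinf g (φ + (0 : ℝ) • θ) (c (φ + (0 : ℝ) • θ))
      (ψ (φ + (0 : ℝ) • θ)) := mem_pure.1 (hpure hsol)
    rwa [hzero] at h
  have hM₀ : ∀ i, ∀ᵐ x ∂(volume.restrict Ω), |(c φ i).fn x| ≤ M := by
    have h : ∀ i, ∀ᵐ x ∂(volume.restrict Ω), |(c (φ + (0 : ℝ) • θ) i).fn x| ≤ M :=
      mem_pure.1 (hpure hM)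
    rwa [hzero] at h
  obtain ⟨K₀, hK₀⟩ := (hOc 0).bound
  obtain ⟨K₁, hK₁⟩ := (hOc 1).bound
  obtain ⟨K₂, hK₂⟩ := hOψ.bound
  let K := max (max K₀ K₁) K₂
  have bound : ∀ {u : H1 Ω} {k t : ℝ}, k ≤ K → ‖u.norm‖ ≤ k * ‖t‖ → u.norm ≤ K * |t| :=
    fun hk hu => (le_abs_self _).trans (hu.trans (mul_le_mul_of_nonneg_right hk (norm_nonneg _)))
  have hgood : ∀ᶠ t in l, t ≠ 0 ∧
      IsPNPSolution P Γ cinf g (φ + t • θ) (c (φ + t • θ)) (ψ (φ + t • θ)) ∧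
      (∀ i, ∀ᵐ x ∂(volume.restrict Ω), |(c (φ + t • θ) i).fn x| ≤ M) ∧
      (∀ i, (c (φ + t • θ) i - c φ i).norm ≤ K * |t|) ∧
      (ψ (φ + t • θ) - ψ φ).norm ≤ K * |t| := by
    filter_upwards [hl self_mem_nhdsWithin, hll' hsol, hll' hM, hll' hK₀, hll' hK₁, hll' hK₂]
      with t h0 h1 h2 h3 h4 h5
    refine ⟨h0, h1, h2, fun i => ?_, bound (le_max_right _ _) h5⟩
    fin_cases i
    · exact bound ((le_max_left _ _).trans (le_max_left _ _)) h3
    · exact bound ((le_max_right _ _).trans (le_max_left _ _)) h4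
  have key : ∀ τ : ℕ → ℝ, Tendsto τ atTop l → ∃ ms : ℕ → ℕ,
      SensitivityIntegrable P φ θ dD dε (c φ) (ψ φ) s ζ ∧
      Tendsto (fun n => slope (fun t : ℝ => J (c (φ + t • θ))) 0 (τ (ms n))) atTop
        (𝓝 (sensitivity P φ θ dD dε (c φ) (ψ φ) s ζ)) := by
    intro τ hτ
    obtain ⟨n₀, hn₀⟩ := eventually_atTop.1 (hτ.eventually hgood)
    have hτ0 : Tendsto τ atTop (𝓝 0) := hτ.mono_right (hl.trans nhdsWithin_le_nhds)
    have hconv : ∀ (i : Fin 2) (m : ℕ → ℕ), Tendsto m atTop atTop → (∀ n, n₀ ≤ m n) →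
        Tendsto (fun n => (c (φ + τ (m n) • θ) i - c φ i).norm) atTop (𝓝 0) := by
      intro i m hm hm'
      refine squeeze_zero (fun n => H1.norm_nonneg _)
        (fun n => (hn₀ (m n) (hm' n)).2.2.2.1 i) ?_
      simpa using ((hτ0.comp hm).abs).const_mul K
    -- One extraction per species, the second inside the first; the shift by `n₀` makes every index
    -- satisfy `hgood`.
    obtain ⟨m₀, hm₀, hae₀⟩ := H1.exists_subseq_tendsto_ae
      (hconv 0 (fun n => n + n₀) (tendsto_add_atTop_nat n₀) fun n => Nat.le_add_left _ _)
    have hm₀' : Tendsto (fun n => m₀ n + n₀) atTop atTop :=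
      (tendsto_add_atTop_nat n₀).comp hm₀.tendsto_atTop
    obtain ⟨m₁, hm₁, hae₁⟩ := H1.exists_subseq_tendsto_ae
      (hconv 1 (fun n => m₀ n + n₀) hm₀' fun n => Nat.le_add_left _ _)
    have hms : Tendsto (fun n => m₀ (m₁ n) + n₀) atTop atTop := hm₀'.comp hm₁.tendsto_atTop
    have good := fun n => hn₀ (m₀ (m₁ n) + n₀) (Nat.le_add_left _ _)
    obtain ⟨hint, htend⟩ := sensitivity_of_seq (dD := dD) (dε := dε)
      (t := fun n => τ (m₀ (m₁ n) + n₀))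
      (C := fun n => c (φ + τ (m₀ (m₁ n) + n₀) • θ)) hφ hadj hθc hθψ hθζ
      (fun n => (good n).1) (hτ0.comp hms) hsol₀ (fun n => (good n).2.1)
      (fun n => (good n).2.2.1) hM₀
      (fun i => by
        fin_cases i
        · exact hae₀.mono fun x hx => hx.comp hm₁.tendsto_atTop
        · exact hae₁)
      (fun n => (good n).2.2.2.1) (fun n => (good n).2.2.2.2)
      (hdD.mono fun x hx => hx.comp (hτ.comp hms)) (hdε.mono fun x hx => hx.comp (hτ.comp hms))
    refine ⟨fun n => m₀ (m₁ n) + n₀, hint, htend.congr fun n => ?_⟩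
    rw [slope_def_field, hzero, sub_zero, div_eq_inv_mul]
  -- Integrability does not involve the sequence, so a single one suffices; the limit needs a good
  -- subsequence of every sequence.
  obtain ⟨τ, hτ⟩ := exists_seq_tendsto l
  refine ⟨(key τ hτ).choose_spec.1, tendsto_of_subseq_tendsto fun τ hτ => ?_⟩
  exact (key τ hτ).imp fun _ h => h.2

end Sensitivity

end PNP

end

theorem mainTheorem2 {d : ℕ} (hd : d = 2 ∨ d = 3) (P : PNP.Params)
    (Ω : Set (PNP.E d)) (hΩo : IsOpen Ω) (hΩb : Bornology.IsBounded Ω)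
    (hΩL : PNP.HasLipschitzBoundary Ω)
    (Γin Γ₁ Γ₂ : Set (PNP.E d)) (h₁ : Disjoint Γin Γ₁) (h₂ : Disjoint Γin Γ₂)
    (h₃ : Disjoint Γ₁ Γ₂) (hΓ : frontier Ω = closure Γin ∪ closure Γ₁ ∪ closure Γ₂)
    -- Dirichlet data, phase field, direction, and the control-to-state map `(c, ψ)`
    (cinf : Fin 2 → PNP.H1 Ω) (g : PNP.H1 Ω)
    (φ : PNP.H1 Ω) (hφ : φ.MemW1Inf) (θ : PNP.H1 Ω)
    (c : PNP.H1 Ω → Fin 2 → PNP.H1 Ω) (ψ : PNP.H1 Ω → PNP.H1 Ω)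
    -- the adjoint state
    (s : Fin 2 → PNP.H1 Ω) (ζ : PNP.H1 Ω)
    (hadj : PNP.IsAdjointSolution P (Γin ∪ Γ₂) φ (c φ) (ψ φ) s ζ)
    -- the products in the claimed formula are integrable (automatic for every `θ ∈ H¹(Ω)`
    -- if `∇c`, `∇ψ` lie in `L⁴(Ω)`)
    (hθc : ∀ i, IntegrableOn
      (fun x => θ.fn x * inner ℝ ((c φ i).grad x) ((s i).grad x)) Ω)
    (hθψ : ∀ i, IntegrableOn
      (fun x => θ.fn x * inner ℝ ((ψ φ).grad x) ((s i).grad x)) Ω)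
    (hθζ : IntegrableOn (fun x => θ.fn x * inner ℝ ((ψ φ).grad x) (ζ.grad x)) Ω) :
    -- one-sided derivative, for all `φ` and `θ`
    (PNP.RegularStateAlong P (Γin ∪ Γ₂) cinf g c ψ φ θ (𝓝[≥] 0) →
      PNP.SensitivityIntegrable P φ θ (fun x => PNP.dirDeriv P.D (φ.fn x) (θ.fn x))
        (fun x => PNP.dirDeriv P.ε (φ.fn x) (θ.fn x)) (c φ) (ψ φ) s ζ ∧
      HasDerivWithinAt (fun t : ℝ => PNP.J (c (φ + t • θ)))
        (PNP.sensitivity P φ θ (fun x => PNP.dirDeriv P.D (φ.fn x) (θ.fn x))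
          (fun x => PNP.dirDeriv P.ε (φ.fn x) (θ.fn x)) (c φ) (ψ φ) s ζ) (Ici 0) 0) ∧
    -- two-sided derivative, where `D` and `ε` are differentiable at `φ` in direction `θ`
    (PNP.RegularStateAlong P (Γin ∪ Γ₂) cinf g c ψ φ θ (𝓝 0) →
      (∀ᵐ x ∂(volume.restrict Ω), θ.fn x = 0 ∨
        DifferentiableAt ℝ P.D (φ.fn x) ∧ DifferentiableAt ℝ P.ε (φ.fn x)) →
      PNP.SensitivityIntegrable P φ θ (fun x => deriv P.D (φ.fn x) * θ.fn x)
        (fun x => deriv P.ε (φ.fn x) * θ.fn x) (c φ) (ψ φ) s ζ ∧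
      HasDerivAt (fun t : ℝ => PNP.J (c (φ + t • θ)))
        (PNP.sensitivity P φ θ (fun x => deriv P.D (φ.fn x) * θ.fn x)
          (fun x => deriv P.ε (φ.fn x) * θ.fn x) (c φ) (ψ φ) s ζ) 0) := by
  -- Finite measure puts L² inside L¹, so the objective is a convergent integral.
  have : IsFiniteMeasure (volume.restrict Ω) :=
    isFiniteMeasure_restrict.2 hΩb.measure_lt_top.ne
  obtain ⟨_, _, hD⟩ := P.exists_materialLaw_D
  obtain ⟨_, _, hε⟩ := P.exists_materialLaw_ε
  refine ⟨fun hreg => ?_, fun hreg hdiff => ?_⟩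
  · have h := PNP.sensitivity_of_filter (l := 𝓝[>] 0)
      (nhdsWithin_mono 0 fun x (hx : 0 < x) => hx.ne') (nhdsWithin_mono 0 Ioi_subset_Ici_self)
      (pure_le_nhdsWithin self_mem_Ici) hφ hadj hθc hθψ hθζ hreg
      (Eventually.of_forall fun x => hD.tendsto_dirDeriv _ _)
      (Eventually.of_forall fun x => hε.tendsto_dirDeriv _ _)
    refine ⟨h.1, HasDerivWithinAt.Ici_of_Ioi ?_⟩
    rw [hasDerivWithinAt_iff_tendsto_slope' self_notMem_Ioi]
    exact h.2
  · have h := PNP.sensitivity_of_filter (l := 𝓝[≠] 0) le_rfl nhdsWithin_le_nhds (pure_le_nhds 0)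
      hφ hadj hθc hθψ hθζ hreg
      (hdiff.mono fun x hx => PNP.tendsto_quotient_of_differentiableAt (hx.imp_right And.left))
      (hdiff.mono fun x hx => PNP.tendsto_quotient_of_differentiableAt (hx.imp_right And.right))
    exact ⟨h.1, hasDerivAt_iff_tendsto_slope.2 h.2⟩
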